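/- Let $\mathbb K$ be a field, let $U$ and $V$ be finite-dimensional vector spaces over $\mathbb K$, and let $S$ be a linear subspace of the space $\mathcal L(U,V)$ of all linear maps from $U$ to $V$; write $\operatorname{codim} S$ for its codimension in $\mathcal L(U,V)$. A map $F : S \to V$ is called local if there is $x \in U$ such that $F(s)=s(x)$ for all $s \in S$. It is called quasi-range-compatible if there is a $1$-dimensional linear subspace $D$ of $V$ such that, for every $s \in S$, $D \not\subset \operatorname{im} s$ implies $F(s) \in \operatorname{im} s$. For $i \in \{1,2\}$, the space $S$ is called special of type $i$ if there is $x \in U$ such that the space $Sx=\{s(x) : s \in S\}$ has dimension $i$. A homomorphism on $S$ is a homomorphism of additive groups $S \to V$. Then: (a) If $\#\mathbb K>3$, $\dim V=2$ and $\operatorname{codim} S \le 2\dim V-3$ (that is, $\operatorname{codim} S\le 1$), then either $S$ is special of type $1$ or every quasi-range-compatible linear map from $S$ to $V$ is local. (b) If $\#\mathbb K>2$ and $\operatorname{codim} S \le 2\dim V-4$, then either $S$ is special of type $1$ or every quasi-range-compatible homomorphism on $S$ is local. (c) If $\#\mathbb K=2$ and $\operatorname{codim} S \le 2\dim V-6$,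 then either $S$ is special of type $1$ or of type $2$, or every quasi-range-compatible homomorphism on $S$ is local. -/

import Mathlib

/-- A map `F : S → V` on a space `S` of operators from `U` to `V` is *local* when it is the
evaluation at some fixed vector of `U`. -/
def IsLocalMap {K U V : Type*} [Field K] [AddCommGroup U] [Module K U] [AddCommGroup V]
    [Module K V] {S : Submodule K (U →ₗ[K] V)} (F : S → V) : Prop :=
  ∃ x : U, ∀ s : S, F s = (s : U →ₗ[K] V) x

/-- `F` is *quasi-range-compatible with respect to `D`*: `F s` belongs to the range of `s`
for every `s ∈ S` whose range does not include `D`. -/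
def QuasiRangeCompatibleWrt {K U V : Type*} [Field K] [AddCommGroup U] [Module K U]
    [AddCommGroup V] [Module K V] {S : Submodule K (U →ₗ[K] V)} (D : Submodule K V)
    (F : S → V) : Prop :=
  ∀ s : S, ¬ D ≤ LinearMap.range (s : U →ₗ[K] V) → F s ∈ LinearMap.range (s : U →ₗ[K] V)

/-- `F` is *quasi-range-compatible* when it is so with respect to some `1`-dimensional linear
subspace of `V`. -/
def QuasiRangeCompatible {K U V : Type*} [Field K] [AddCommGroup U] [Module K U]
    [AddCommGroup V] [Module K V] {S : Submodule K (U →ₗ[K] V)} (F : S → V) : Prop :=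
  ∃ D : Submodule K V, Module.finrank K D = 1 ∧ QuasiRangeCompatibleWrt D F

/-- The linear subspace `S x = {s x | s ∈ S}` of `V`. -/
def evalSpace {K U V : Type*} [Field K] [AddCommGroup U] [Module K U] [AddCommGroup V]
    [Module K V] (S : Submodule K (U →ₗ[K] V)) (x : U) : Submodule K V :=
  S.map (LinearMap.applyₗ x)

/-- `S` is *special of type `i`* when `dim S x = i` for some `x ∈ U`. -/
def IsSpecialOfType {K U V : Type*} [Field K] [AddCommGroup U] [Module K U] [AddCommGroup V]
    [Module K V] (S : Submodule K (U →ₗ[K] V)) (i : ℕ) : Prop :=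
  ∃ x : U, Module.finrank K (evalSpace S x) = i

/-- The codimension of `S` in the space of all linear maps from `U` to `V`. -/
noncomputable def codimOp {K U V : Type*} [Field K] [AddCommGroup U] [Module K U]
    [AddCommGroup V] [Module K V] (S : Submodule K (U →ₗ[K] V)) : ℕ :=
  Module.finrank K ((U →ₗ[K] V) ⧸ S)

/-! Parts (b) and (c) are one statement with a parameter `e`: if each nonzero `S x` has dimension at
least `e` and codim S ≤ 2 dim V - 2e, then `F` is local. Here `e = 2` if the field has an element
other than 0 and 1, and `e = 3` otherwise.

One tool splits the source. If `F` is local on the operators vanishing at `x`, subtracting an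
evaluation gives an additive map `g : S x → V`. Many linear forms `φ` kill `p` but neither `d` (a
generator of D) nor `g p`; when the codimension is small, one of them admits `s ∈ S` with `s x = p`
and `φ ∘ s = 0`, and this `s` violates quasi-range-compatibility. So `g p` lies on the line of `p`
whenever `p` is outside D, which makes `g` a homothety (`isLocalMap_of_vanishingAt`). Induction on
dim U then settles codim S ≤ dim V - e.

The other tool quotients the target by a vector `y`, in an induction on dim V
(`isLocalMap_of_finrank_evalSpace`). If this lowers the codimension by at least 2 for two
independent vectors outside D, `F` is an evaluation modulo each of them. The two evaluation points
agree because all `S x` with `x ≠ 0` are large, and the two lines meet in 0. Such vectors are the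
nonzeros of a quadratic form. If all these forms vanish, S has codimension at most 1 or contains
every operator vanishing at some nonzero `u`; both are covered by easier cases.

Part (a) uses duality: for `φ d ≠ 0`, the form `φ ∘ F` is an evaluation followed by `φ`. Comparing
several `φ` yields elements of the annihilator of S, whose dimension is at most 1. -/

theorem AddMonoidHom.exists_factor {A B C : Type*} [AddCommGroup A] [AddCommGroup B]
    [AddCommGroup C] (f : A →+ B) (hf : Function.Surjective f) (g : A →+ C)
    (h : ∀ a, f a = 0 → g a = 0) : ∃ k : B →+ C, ∀ a, k (f a) = g a := by
  refine ⟨f.liftOfRightInverse (Function.surjInv hf) (Function.rightInverse_surjInv hf)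
    ⟨g, fun a ha => h a ha⟩, fun a => ?_⟩
  exact AddMonoidHom.liftOfRightInverse_comp_apply f _ (Function.rightInverse_surjInv hf) _ a

/-! ### Additive maps with many eigenvectors. -/

section
variable {K V : Type*} [Field K] [AddCommGroup V] [Module K V]

theorem Submodule.exists_notMem_of_finrank_lt [FiniteDimensional K V] (P Q : Submodule K V)
    (h : Module.finrank K Q < Module.finrank K P) : ∃ r ∈ P, r ∉ Q := by
  by_contra! hc
  exact absurd (Submodule.finrank_mono (show P ≤ Q from hc)) (by omega)

theorem finrank_span_pair_le (a b : V) : Module.finrank K (Submodule.span K {a, b}) ≤ 2 := by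
  classical
  refine (finrank_span_le_card (R := K) ({a, b} : Set V)).trans ?_
  simpa using Finset.card_le_two (a := a) (b := b)

theorem finrank_span_triple_le (a b c : V) :
    Module.finrank K (Submodule.span K {a, b, c}) ≤ 3 := by
  classical
  refine (finrank_span_le_card (R := K) ({a, b, c} : Set V)).trans ?_
  simpa using Finset.card_le_three (a := a) (b := b) (c := c)

theorem finrank_span_singleton_le (a : V) : Module.finrank K (Submodule.span K {a}) ≤ 1 := by
  classical
  refine (finrank_span_le_card (R := K) ({a} : Set V)).trans ?_
  simp

theorem eq_zero_of_smul_add_smul_eq_zero {p q : V} (hp : p ≠ 0) (hq : q ∉ Submodule.span K {p})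
    {s t : K} (h : s • p + t • q = 0) : s = 0 ∧ t = 0 := by
  have ht : t = 0 := by
    by_contra ht
    refine hq (Submodule.mem_span_singleton.2 ⟨-(t⁻¹ * s), ?_⟩)
    have h2 : q = t⁻¹ • (t • q) := by rw [smul_smul, inv_mul_cancel₀ ht, one_smul]
    rw [h2, eq_neg_of_add_eq_zero_right h, smul_neg, smul_smul, neg_smul]
  subst ht
  refine ⟨?_, rfl⟩
  simpa [hp] using h

/-- An additive map for which every vector outside a line is an eigenvector is a homothety, as soon
as the space is not too small. -/
theorem AddMonoidHom.exists_eq_smul_of_eigen_off_line [FiniteDimensional K V] {e : ℕ} (he : 2 ≤ e)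
    (hK : 3 ≤ e ∨ ∃ α : K, α ≠ 0 ∧ α ≠ 1) (P : Submodule K V) (hP : e ≤ Module.finrank K P)
    (d : V) (g : P →+ V)
    (hg : ∀ p : P, (p : V) ∉ Submodule.span K {d} → g p ∈ Submodule.span K {(p : V)}) :
    ∃ l : K, ∀ p : P, g p = l • (p : V) := by
  have hg' : ∀ p : P, (p : V) ∉ Submodule.span K {d} → ∃ l : K, g p = l • (p : V) := by
    intro p hp
    obtain ⟨l, hl⟩ := Submodule.mem_span_singleton.1 (hg p hp)
    exact ⟨l, hl.symm⟩
  have h1 : ∀ p q : P, ∀ l m : K, (p : V) ≠ 0 → (q : V) ∉ Submodule.span K {(p : V)} →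
      (p : V) + q ∉ Submodule.span K {d} → g p = l • (p : V) → g q = m • (q : V) → l = m := by
    intro p q l m hp hq hpq hl hm
    obtain ⟨r, hr⟩ := hg' (p + q) hpq
    rw [map_add, hl, hm] at hr
    have h0 : (l - r) • (p : V) + (m - r) • (q : V) = 0 := by
      have : l • (p : V) + m • (q : V) - r • ((p : V) + q) = 0 := by
        rw [hr]; simp
      rw [← this]; module
    obtain ⟨ha, hb⟩ := eq_zero_of_smul_add_smul_eq_zero hp hq h0
    rw [sub_eq_zero.1 ha, sub_eq_zero.1 hb]
  have h2 : ∀ p q : P, ∀ l m : K, (p : V) ∉ Submodule.span K {d} →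
      (q : V) ∉ Submodule.span K {d} → (q : V) ∉ Submodule.span K {(p : V)} →
      g p = l • (p : V) → g q = m • (q : V) → l = m := by
    intro p q l m hp hq hpq hl hm
    have hp0 : (p : V) ≠ 0 := fun h => hp (h ▸ zero_mem _)
    by_cases hs : (p : V) + q ∈ Submodule.span K {d}
    swap
    · exact h1 p q l m hp0 hpq hs hl hm
    obtain ⟨k, hk⟩ := Submodule.mem_span_singleton.1 hs
    have hk0 : k ≠ 0 := by
      rintro rfl
      have := eq_zero_of_smul_add_smul_eq_zero (s := (1 : K)) (t := 1) hp0 hpq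
        (by rw [one_smul, one_smul, ← hk, zero_smul])
      exact one_ne_zero this.1
    have hd : d = k⁻¹ • ((p : V) + q) := by rw [← hk, smul_smul, inv_mul_cancel₀ hk0, one_smul]
    -- a combination of `p` and `q` on the line has equal coefficients
    have hcomb : ∀ s t : K, s • (p : V) + t • (q : V) ∈ Submodule.span K {d} → s = t := by
      intro s t h
      obtain ⟨c, hc⟩ := Submodule.mem_span_singleton.1 h
      have h0 : (s - c * k⁻¹) • (p : V) + (t - c * k⁻¹) • (q : V) = 0 := by
        have : s • (p : V) + t • (q : V) - c • d = 0 := by rw [hc]; simp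
        rw [← this, hd]; module
      obtain ⟨ha, hb⟩ := eq_zero_of_smul_add_smul_eq_zero hp0 hpq h0
      rw [sub_eq_zero.1 ha, sub_eq_zero.1 hb]
    -- The sum `p + q` lies on the excluded line: compare through a third vector outside the plane
    -- of `p` and `q`, or else inside that plane by means of `α`.
    rcases hK with hK | ⟨α, hα0, hα1⟩
    · obtain ⟨r, hrP, hr⟩ := Submodule.exists_notMem_of_finrank_lt P
        (Submodule.span K {(p : V), (q : V)}) (by
          have := finrank_span_pair_le (K := K) (p : V) (q : V); omega)
      have hpm : (p : V) ∈ Submodule.span K {(p : V), (q : V)} := Submodule.subset_span (by simp)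
      have hqm : (q : V) ∈ Submodule.span K {(p : V), (q : V)} := Submodule.subset_span (by simp)
      have hdm : d ∈ Submodule.span K {(p : V), (q : V)} := by
        rw [hd]; exact Submodule.smul_mem _ _ (add_mem hpm hqm)
      have hline : ∀ v ∈ Submodule.span K {(p : V), (q : V)},
          Submodule.span K {v} ≤ Submodule.span K {(p : V), (q : V)} := fun v hv => by
        rwa [Submodule.span_singleton_le_iff_mem]
      obtain ⟨n, hn⟩ := hg' ⟨r, hrP⟩ (fun h => hr (hline d hdm h))
      have e1 := h1 p ⟨r, hrP⟩ l n hp0 (fun h => hr (hline _ hpm h))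
        (fun h => hr (by simpa using sub_mem (hline d hdm h) hpm)) hl hn
      have e2 := h1 q ⟨r, hrP⟩ m n (fun h => hq (h ▸ zero_mem _)) (fun h => hr (hline _ hqm h))
        (fun h => hr (by simpa using sub_mem (hline d hdm h) hqm)) hm hn
      rw [e1, e2]
    -- As `g` is only additive, `α • p` and `α • q` may have their own eigenvalues. The pairs `p, α
    -- • q` and `α • p, q` have sums off the line, so these eigenvalues are `l` and `m`; the
    -- eigenvector `p - α • p - α • q` then forces `l = m`.
    · obtain ⟨m', hm'⟩ := hg' (α • q) (fun h => hα0 (hcomb 0 α (by simpa using h)).symm)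
      obtain ⟨l', hl'⟩ := hg' (α • p) (fun h => hα0 (hcomb α 0 (by simpa using h)))
      have e1 : l = m' := h1 p (α • q) l m' hp0
        (fun h => hpq (by simpa [smul_smul, hα0] using Submodule.smul_mem _ α⁻¹ h))
        (fun h => hα1 (hcomb 1 α (by simpa using h)).symm) hl hm'
      have e2 : l' = m := h1 (α • p) q l' m (by simpa [hα0] using hp0)
        (fun h => hpq (Submodule.span_singleton_le_iff_mem _ _ |>.2
          (Submodule.smul_mem _ α (Submodule.mem_span_singleton_self _)) h))
        (fun h => hα1 (hcomb α 1 (by simpa using h))) hl' hm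
      subst e1 e2
      obtain ⟨r, hr⟩ := hg' (p - α • p - α • q) (fun h => by
        have := hcomb (1 - α) (-α) (by
          convert h using 1
          simp only [Submodule.coe_sub, Submodule.coe_smul]; module)
        exact one_ne_zero (α := K) (by linear_combination this))
      rw [map_sub, map_sub, hl, hl', hm'] at hr
      simp only [Submodule.coe_sub, Submodule.coe_smul] at hr
      have h0 : (l - α * l' - r * (1 - α)) • (p : V) + (r * α - α * l) • (q : V) = 0 := by
        have := sub_eq_zero.2 hr
        rw [← this]; module
      obtain ⟨ha, hb⟩ := eq_zero_of_smul_add_smul_eq_zero hp0 hpq h0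
      have hrl : r = l := mul_right_cancel₀ hα0 (by linear_combination hb)
      subst hrl
      exact (mul_left_cancel₀ hα0 (by linear_combination -ha)).symm
  obtain ⟨p, hpP, hp⟩ := Submodule.exists_notMem_of_finrank_lt P (Submodule.span K {d}) (by
    have := finrank_span_singleton_le (K := K) d; omega)
  obtain ⟨l, hl⟩ := hg' ⟨p, hpP⟩ hp
  have hp0 : p ≠ 0 := fun h => hp (h ▸ zero_mem _)
  obtain ⟨r, hrP, hrp, hrd⟩ : ∃ r ∈ P, r ∉ Submodule.span K {p} ∧ r ∉ Submodule.span K {d} := by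
    obtain ⟨r, hrP, hr⟩ := Submodule.exists_notMem_of_finrank_lt P (Submodule.span K {p}) (by
      have := finrank_span_singleton_le (K := K) p; omega)
    by_cases h : r ∈ Submodule.span K {d}
    · refine ⟨r + p, add_mem hrP hpP, fun h' => hr ?_, fun h' => hp ?_⟩
      · simpa using sub_mem h' (Submodule.mem_span_singleton_self p)
      · simpa using sub_mem h' h
    · exact ⟨r, hrP, hr, h⟩
  obtain ⟨n, hn⟩ := hg' ⟨r, hrP⟩ hrd
  have hln : l = n := h2 ⟨p, hpP⟩ ⟨r, hrP⟩ l n hp hrd hrp hl hn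
  have h3 : ∀ q : P, (q : V) ∉ Submodule.span K {d} → g q = l • (q : V) := by
    intro q hq
    obtain ⟨m, hm⟩ := hg' q hq
    by_cases hqp : (q : V) ∈ Submodule.span K {p}
    · have hqr : (q : V) ∉ Submodule.span K {r} := by
        intro h
        obtain ⟨a, ha⟩ := Submodule.mem_span_singleton.1 hqp
        obtain ⟨b, hb⟩ := Submodule.mem_span_singleton.1 h
        have := eq_zero_of_smul_add_smul_eq_zero (s := a) (t := -b) hp0 hrp
          (by rw [ha, neg_smul, hb]; simp)
        rw [this.1, zero_smul] at ha
        exact hq (ha ▸ zero_mem _)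
      rw [hm, hln, h2 ⟨r, hrP⟩ q n m hrd hq hqr hn hm]
    · rw [hm, h2 ⟨p, hpP⟩ q l m hp hq hqp hl hm]
  refine ⟨l, fun q => ?_⟩
  by_cases hq : (q : V) ∈ Submodule.span K {d}
  · have h4 := h3 (q - ⟨p, hpP⟩) (fun h => hp (by simpa using sub_mem hq h))
    rw [map_sub, hl] at h4
    simp only [Submodule.coe_sub, smul_sub] at h4
    exact sub_left_injective h4
  · exact h3 q hq

end

/-! ### Counting linear forms, and operators vanishing at a vector. -/

section
variable {K U V : Type*} [Field K] [AddCommGroup U] [Module K U] [AddCommGroup V] [Module K V]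

theorem exists_dual_eq_zero_of_notMem_span {p d w : V} (hd : d ∉ Submodule.span K {p})
    (hw : w ∉ Submodule.span K {p}) :
    ∃ φ : Module.Dual K V, φ p = 0 ∧ φ d ≠ 0 ∧ φ w ≠ 0 := by
  obtain ⟨φ, hφd, hφ⟩ := Submodule.exists_le_ker_of_notMem hd
  obtain ⟨ψ, hψw, hψ⟩ := Submodule.exists_le_ker_of_notMem hw
  have hφp : φ p = 0 := hφ (Submodule.mem_span_singleton_self p)
  have hψp : ψ p = 0 := hψ (Submodule.mem_span_singleton_self p)
  by_cases h1 : φ w = 0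
  · by_cases h2 : ψ d = 0
    · exact ⟨φ + ψ, by simp [hφp, hψp], by simp [h2, hφd], by simp [h1, hψw]⟩
    · exact ⟨ψ, hψp, h2, hψw⟩
  · exact ⟨φ, hφp, hφd, h1⟩

/-- With a scalar `α` other than 0 and 1, each form killing `p` becomes admissible after adding a
suitable multiple of an admissible `v`, so the span has dimension at least dim V - 1. Without it,
one gets the forms killing `p`, `d`, `w` and also `v`, hence at least dim V - 2. -/
theorem finrank_span_dual_avoiding [FiniteDimensional K V] {e : ℕ} (he : 2 ≤ e)
    (hK : 3 ≤ e ∨ ∃ α : K, α ≠ 0 ∧ α ≠ 1) {p d w : V} (hd : d ∉ Submodule.span K {p})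
    (hw : w ∉ Submodule.span K {p}) :
    Module.finrank K V + 1 ≤
      Module.finrank K (Submodule.span K
        {φ : Module.Dual K V | φ p = 0 ∧ φ d ≠ 0 ∧ φ w ≠ 0}) + e := by
  set M := Submodule.span K {φ : Module.Dual K V | φ p = 0 ∧ φ d ≠ 0 ∧ φ w ≠ 0} with hM
  obtain ⟨v, hvp, hvd, hvw⟩ := exists_dual_eq_zero_of_notMem_span hd hw
  have hvM : v ∈ M := Submodule.subset_span ⟨hvp, hvd, hvw⟩
  rcases hK with hK | ⟨α, hα0, hα1⟩
  · have h1 := Subspace.finrank_add_finrank_dualAnnihilator_eq (Submodule.span K {p, d, w})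
    have h2 := finrank_span_triple_le (K := K) p d w
    have h3 : (Submodule.span K {p, d, w}).dualAnnihilator < M := by
      refine lt_of_le_of_ne (fun ψ hψ => ?_) (fun h => ?_)
      · rw [Submodule.mem_dualAnnihilator] at hψ
        have hp := hψ p (Submodule.subset_span (by simp))
        have hd := hψ d (Submodule.subset_span (by simp))
        have hw := hψ w (Submodule.subset_span (by simp))
        have : ψ + v ∈ M := Submodule.subset_span
          ⟨by simp [hp, hvp], by simp [hd, hvd], by simp [hw, hvw]⟩
        simpa using sub_mem this hvM
      · rw [← h, Submodule.mem_dualAnnihilator] at hvM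
        exact hvd (hvM d (Submodule.subset_span (by simp)))
    have h4 := Submodule.finrank_lt_finrank_of_lt h3
    omega
  · have h1 := Subspace.finrank_add_finrank_dualAnnihilator_eq (Submodule.span K {p})
    have h2 := finrank_span_singleton_le (K := K) p
    have h3 : (Submodule.span K {p}).dualAnnihilator ≤ M := by
      intro ψ hψ
      rw [Submodule.mem_dualAnnihilator] at hψ
      have hp := hψ p (Submodule.subset_span (by simp))
      have key : ∀ l : K, ψ d + l * v d ≠ 0 → ψ w + l * v w ≠ 0 → ψ ∈ M := by
        intro l hl1 hl2
        have : ψ + l • v ∈ M := Submodule.subset_span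
          ⟨by simp [hp, hvp], by simpa using hl1, by simpa using hl2⟩
        simpa using sub_mem this (Submodule.smul_mem _ l hvM)
      have two : ∀ a b : K, b ≠ 0 → a + 1 * b = 0 → a + α * b ≠ 0 := by
        intro a b hb h h'
        have : (α - 1) * b = 0 := by linear_combination h' - h
        rcases mul_eq_zero.1 this with h | h
        · exact hα1 (sub_eq_zero.1 h)
        · exact hb h
      by_cases h1 : ψ d = 0
      · by_cases h2 : ψ w + 1 * v w = 0
        · exact key α (by simp [h1, hα0, hvd]) (two _ _ hvw h2)
        · exact key 1 (by simp [h1, hvd]) h2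
      · by_cases h2 : ψ w = 0
        · by_cases h3 : ψ d + 1 * v d = 0
          · exact key α (two _ _ hvd h3) (by simp [h2, hα0, hvw])
          · exact key 1 h3 (by simp [h2, hvw])
        · exact Submodule.subset_span ⟨hp, h1, h2⟩
    have h4 := Submodule.finrank_mono h3
    omega

/-- The operators of `S` that vanish at `x`, seen as operators on `U ⧸ span {x}`. -/
def vanishingAt (S : Submodule K (U →ₗ[K] V)) (x : U) :
    Submodule K ((U ⧸ Submodule.span K {x}) →ₗ[K] V) :=
  S.comap (LinearMap.lcomp K V (Submodule.span K {x}).mkQ)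

theorem mem_vanishingAt {S : Submodule K (U →ₗ[K] V)} {x : U}
    {s : (U ⧸ Submodule.span K {x}) →ₗ[K] V} :
    s ∈ vanishingAt S x ↔ s ∘ₗ (Submodule.span K {x}).mkQ ∈ S := Iff.rfl

theorem exists_vanishingAt {S : Submodule K (U →ₗ[K] V)} {x : U} {s : U →ₗ[K] V} (hs : s ∈ S)
    (hx : s x = 0) : ∃ s' ∈ vanishingAt S x, s' ∘ₗ (Submodule.span K {x}).mkQ = s := by
  have h : Submodule.span K {x} ≤ LinearMap.ker s := by
    rw [Submodule.span_singleton_le_iff_mem]; exact hx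
  refine ⟨(Submodule.span K {x}).liftQ s h, ?_, Submodule.liftQ_mkQ _ _ h⟩
  rw [mem_vanishingAt, Submodule.liftQ_mkQ]
  exact hs

theorem mem_evalSpace {S : Submodule K (U →ₗ[K] V)} {x : U} {v : V} :
    v ∈ evalSpace S x ↔ ∃ s ∈ S, s x = v := Iff.rfl

variable [FiniteDimensional K U] [FiniteDimensional K V]

theorem codimOp_add_finrank (S : Submodule K (U →ₗ[K] V)) :
    codimOp S + Module.finrank K S = Module.finrank K U * Module.finrank K V := by
  rw [codimOp, Submodule.finrank_quotient_add_finrank, Module.finrank_linearMap]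

theorem finrank_dualAnnihilator_eq_codimOp (S : Submodule K (U →ₗ[K] V)) :
    Module.finrank K S.dualAnnihilator = codimOp S := by
  have h1 := Subspace.finrank_add_finrank_dualAnnihilator_eq S
  have h2 := Submodule.finrank_quotient_add_finrank S
  unfold codimOp
  omega

/-- Linear forms `φ` such that `φ ∘ S` is not the whole dual of `U` are rare. -/
theorem finrank_span_le_codimOp (S : Submodule K (U →ₗ[K] V)) (Φ : Set (Module.Dual K V))
    (hΦ : ∀ φ ∈ Φ, ∃ u : U, u ≠ 0 ∧ ∀ s ∈ S, φ (s u) = 0) :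
    Module.finrank K (Submodule.span K Φ) ≤ codimOp S := by
  obtain ⟨b, hb, hspan, hli⟩ := exists_linearIndependent K Φ
  have : Fintype b := hli.setFinite.fintype
  have hb' : ∀ φ : b, ∃ u : U, u ≠ 0 ∧ ∀ s ∈ S, φ.1 (s u) = 0 := fun φ => hΦ φ.1 (hb φ.2)
  choose u hu0 hu using hb'
  -- The tensors `φ ⊗ u φ` annihilate S. Their independence is tested on rank-one operators, with
  -- `f` chosen nonzero at `u φ₀`.
  let w : b → Module.Dual K (U →ₗ[K] V) := fun φ => φ.1 ∘ₗ LinearMap.applyₗ (u φ)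
  have hwS : Submodule.span K (Set.range w) ≤ S.dualAnnihilator := by
    rw [Submodule.span_le]
    rintro _ ⟨φ, rfl⟩
    exact (Submodule.mem_dualAnnihilator _).2 fun s hs => hu φ s hs
  have hw : LinearIndependent K w := by
    rw [Fintype.linearIndependent_iff]
    intro a ha φ₀
    obtain ⟨f, hf⟩ : ∃ f : Module.Dual K U, f (u φ₀) ≠ 0 := by
      by_contra! h
      exact hu0 φ₀ ((Module.forall_dual_apply_eq_zero_iff K _).1 h)
    have h1 : ∑ φ : b, (a φ * f (u φ)) • φ.1 = 0 := by
      ext v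
      have h2 := LinearMap.congr_fun ha (f.smulRight v)
      simp only [LinearMap.sum_apply, LinearMap.smul_apply] at h2
      simpa [w, mul_assoc] using h2
    have h3 := Fintype.linearIndependent_iff.1 hli _ h1 φ₀
    exact (mul_eq_zero.1 h3).resolve_right hf
  have h1 := Submodule.finrank_mono hwS
  rw [finrank_dualAnnihilator_eq_codimOp, finrank_span_eq_card hw] at h1
  rw [← hspan, finrank_span_set_eq_card hli, Set.toFinset_card]
  exact h1

theorem finrank_quotient_span_singleton_add_one {x : U} (hx : x ≠ 0) :
    Module.finrank K (U ⧸ Submodule.span K {x}) + 1 = Module.finrank K U := by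
  rw [← Submodule.finrank_quotient_add_finrank (Submodule.span K {x}), finrank_span_singleton hx]

/-- Rank-nullity for the evaluation of S at `x`. -/
theorem codimOp_vanishingAt_add (S : Submodule K (U →ₗ[K] V)) {x : U} (hx : x ≠ 0) :
    codimOp (vanishingAt S x) + Module.finrank K V =
      codimOp S + Module.finrank K (evalSpace S x) := by
  have h1 := codimOp_add_finrank S
  have h2 := codimOp_add_finrank (vanishingAt S x)
  have h3 := finrank_quotient_span_singleton_add_one (K := K) hx
  have h4 : Module.finrank K (evalSpace S x) + Module.finrank K (vanishingAt S x) =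
      Module.finrank K S := by
    let ev : S →ₗ[K] V := (LinearMap.applyₗ x).domRestrict S
    have hr : LinearMap.range ev = evalSpace S x := by
      ext v
      simp [ev, mem_evalSpace]
    rw [← LinearMap.finrank_range_add_finrank_ker ev, hr]
    congr 1
    let j : vanishingAt S x →ₗ[K] LinearMap.ker ev :=
      { toFun := fun s => ⟨⟨s.1 ∘ₗ (Submodule.span K {x}).mkQ, s.2⟩, by
          have : (Submodule.span K {x}).mkQ x = 0 :=
            (Submodule.Quotient.mk_eq_zero _).2 (Submodule.mem_span_singleton_self x)
          change s.1 ((Submodule.span K {x}).mkQ x) = 0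
          rw [this, map_zero]⟩
        map_add' := fun _ _ => rfl
        map_smul' := fun _ _ => rfl }
    refine (LinearEquiv.ofBijective j ⟨fun s t h => ?_, fun s => ?_⟩).finrank_eq
    · have h' : s.1 ∘ₗ (Submodule.span K {x}).mkQ = t.1 ∘ₗ (Submodule.span K {x}).mkQ :=
        congrArg (fun z : LinearMap.ker ev => z.1.1) h
      exact Subtype.ext (LinearMap.cancel_right (Submodule.mkQ_surjective _) |>.1 h')
    · obtain ⟨s', hs', h⟩ := exists_vanishingAt s.1.2 (show s.1.1 x = 0 from s.2)
      exact ⟨⟨s', hs'⟩, Subtype.ext (Subtype.ext h)⟩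
  rw [← h3, add_mul, one_mul] at h1
  omega

end

/-! ### Splitting the source along a vector. -/

section
variable {K U V : Type*} [Field K] [AddCommGroup U] [Module K U] [AddCommGroup V] [Module K V]

theorem quasiRangeCompatibleWrt_span_singleton_iff {S : Submodule K (U →ₗ[K] V)} {d : V}
    {F : S → V} : QuasiRangeCompatibleWrt (Submodule.span K {d}) F ↔
      ∀ s : S, d ∉ LinearMap.range (s : U →ₗ[K] V) → F s ∈ LinearMap.range (s : U →ₗ[K] V) := by
  simp only [QuasiRangeCompatibleWrt, Submodule.span_singleton_le_iff_mem]

/-- The evaluation of the operators of `S` at `x`, with values in `S x`. -/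
def evalHom (S : Submodule K (U →ₗ[K] V)) (x : U) : S →+ evalSpace S x where
  toFun s := ⟨s.1 x, mem_evalSpace.2 ⟨s.1, s.2, rfl⟩⟩
  map_zero' := by simp
  map_add' s t := by ext; simp

/-- The difference of a homomorphism and of the evaluation at `x`. -/
def subEval {S : Submodule K (U →ₗ[K] V)} (F : S →+ V) (x : U) : S →+ V where
  toFun s := F s - s.1 x
  map_zero' := by simp
  map_add' s t := by simp; abel

theorem QuasiRangeCompatibleWrt.subEval {S : Submodule K (U →ₗ[K] V)} {F : S →+ V}
    {D : Submodule K V} (hF : QuasiRangeCompatibleWrt D F) (x : U) :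
    QuasiRangeCompatibleWrt D (subEval F x) :=
  fun s hs => sub_mem (hF s hs) (LinearMap.mem_range_self _ x)

theorem IsLocalMap.of_subEval {S : Submodule K (U →ₗ[K] V)} {F : S →+ V} {x : U}
    (h : IsLocalMap (subEval F x)) : IsLocalMap F := by
  obtain ⟨y, hy⟩ := h
  refine ⟨x + y, fun s => ?_⟩
  have : F s - s.1 x = s.1 y := hy s
  rw [map_add, ← this]; abel

variable [FiniteDimensional K U] [FiniteDimensional K V]

/-- By `finrank_span_le_codimOp`, some `φ ∈ Φ` is such that composing it with the operators
vanishing at `x` gives the whole dual of `U ⧸ span {x}`. Any operator sending `x` to `p` can then be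
corrected so that `φ` kills its range. -/
theorem exists_mem_apply_eq_and_comp_eq_zero (S : Submodule K (U →ₗ[K] V)) {x : U}
    (Φ : Set (Module.Dual K V))
    (hΦ : codimOp (vanishingAt S x) < Module.finrank K (Submodule.span K Φ))
    {p : V} (hp : p ∈ evalSpace S x) (hΦp : ∀ φ ∈ Φ, φ p = 0) :
    ∃ φ ∈ Φ, ∃ s ∈ S, s x = p ∧ ∀ u, φ (s u) = 0 := by
  obtain ⟨φ, hφ, hgood⟩ : ∃ φ ∈ Φ, ∀ u : U ⧸ Submodule.span K {x},
      (∀ s ∈ vanishingAt S x, φ (s u) = 0) → u = 0 := by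
    by_contra! h
    refine absurd (finrank_span_le_codimOp (vanishingAt S x) Φ fun φ hφ => ?_) (by omega)
    obtain ⟨u, h1, h2⟩ := h φ hφ
    exact ⟨u, h2, h1⟩
  obtain ⟨s₀, hs₀, hs₀x⟩ := mem_evalSpace.1 hp
  -- the forms `φ ∘ s'` fill the whole dual space
  let T : (vanishingAt S x) →ₗ[K] Module.Dual K (U ⧸ Submodule.span K {x}) :=
    { toFun := fun s => φ ∘ₗ s.1
      map_add' := fun s t => by ext; simp
      map_smul' := fun c s => by ext; simp }
  have hT : LinearMap.range T = ⊤ := by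
    rw [← Subspace.dualCoannihilator_dualAnnihilator_eq (W := LinearMap.range T)]
    have : (LinearMap.range T).dualCoannihilator = ⊥ := by
      rw [eq_bot_iff]
      intro u hu
      rw [Submodule.mem_dualCoannihilator] at hu
      exact hgood u fun s hs => hu (T ⟨s, hs⟩) (LinearMap.mem_range_self _ _)
    rw [this, Submodule.dualAnnihilator_bot]
  have hle : Submodule.span K {x} ≤ LinearMap.ker (φ ∘ₗ s₀) := by
    rw [Submodule.span_singleton_le_iff_mem, LinearMap.mem_ker, LinearMap.comp_apply, hs₀x]
    exact hΦp φ hφ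
  obtain ⟨s', hs'⟩ : (Submodule.span K {x}).liftQ (φ ∘ₗ s₀) hle ∈ LinearMap.range T :=
    hT ▸ Submodule.mem_top
  have hx : (Submodule.span K {x}).mkQ x = 0 :=
    (Submodule.Quotient.mk_eq_zero _).2 (Submodule.mem_span_singleton_self x)
  refine ⟨φ, hφ, s₀ - s'.1 ∘ₗ (Submodule.span K {x}).mkQ, sub_mem hs₀ s'.2, ?_, fun u => ?_⟩
  · rw [LinearMap.sub_apply, LinearMap.comp_apply, hx, map_zero, sub_zero, hs₀x]
  · have h := LinearMap.congr_fun hs' ((Submodule.span K {x}).mkQ u)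
    have h' : φ (s'.1 ((Submodule.span K {x}).mkQ u)) = φ (s₀ u) := h
    rw [LinearMap.sub_apply, LinearMap.comp_apply, map_sub, h', sub_self]

theorem isLocalMap_of_eq_zero_of_apply_eq_zero {e : ℕ} (he : 2 ≤ e)
    (hK : 3 ≤ e ∨ ∃ α : K, α ≠ 0 ∧ α ≠ 1) {S : Submodule K (U →ₗ[K] V)} {x : U}
    (hx : e ≤ Module.finrank K (evalSpace S x))
    (hc : codimOp (vanishingAt S x) + e ≤ Module.finrank K V) {d : V} (hd : d ≠ 0) {F : S →+ V}
    (hF : QuasiRangeCompatibleWrt (Submodule.span K {d}) F)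
    (h0 : ∀ s : S, s.1 x = 0 → F s = 0) : IsLocalMap F := by
  rw [quasiRangeCompatibleWrt_span_singleton_iff] at hF
  obtain ⟨g, hg⟩ := AddMonoidHom.exists_factor (evalHom S x)
    (fun p => by
      obtain ⟨s, hs, h⟩ := mem_evalSpace.1 p.2
      exact ⟨⟨s, hs⟩, Subtype.ext h⟩) F (fun s hs => h0 s (congrArg Subtype.val hs))
  -- If `g p` left the line of `p`, an operator with range in `ker φ`, where `φ d ≠ 0` and `φ (g p)
  -- ≠ 0`, would contradict quasi-range-compatibility.
  obtain ⟨l, hl⟩ := AddMonoidHom.exists_eq_smul_of_eigen_off_line he hK (evalSpace S x) hx d g (by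
    intro p hp
    by_contra hgp
    have hdp : d ∉ Submodule.span K {(p : V)} := by
      intro h
      obtain ⟨a, ha⟩ := Submodule.mem_span_singleton.1 h
      have ha0 : a ≠ 0 := by rintro rfl; exact hd (by rw [← ha, zero_smul])
      exact hp (Submodule.mem_span_singleton.2
        ⟨a⁻¹, by rw [← ha, smul_smul, inv_mul_cancel₀ ha0, one_smul]⟩)
    have h1 := finrank_span_dual_avoiding he hK hdp hgp
    obtain ⟨φ, ⟨-, hφd, hφg⟩, s, hs, hsx, hφs⟩ := exists_mem_apply_eq_and_comp_eq_zero S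
      (x := x) {φ : Module.Dual K V | φ p = 0 ∧ φ d ≠ 0 ∧ φ (g p) ≠ 0} (by omega) p.2
      (fun φ hφ => hφ.1)
    have h2 : F ⟨s, hs⟩ ∈ LinearMap.range s := hF ⟨s, hs⟩ (by
      rintro ⟨u, hu⟩
      exact hφd (hu ▸ hφs u))
    have h3 : F ⟨s, hs⟩ = g p := by
      rw [← hg]; exact congrArg g (Subtype.ext hsx)
    obtain ⟨u, hu⟩ := h2
    exact hφg (by rw [← h3, ← hu]; exact hφs u))
  refine ⟨l • x, fun s => ?_⟩
  rw [← hg, hl, map_smul]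
  rfl

theorem isLocalMap_of_vanishingAt {e : ℕ} (he : 2 ≤ e)
    (hK : 3 ≤ e ∨ ∃ α : K, α ≠ 0 ∧ α ≠ 1) {S : Submodule K (U →ₗ[K] V)} {x : U}
    (hx : Module.finrank K (evalSpace S x) = 0 ∨ e ≤ Module.finrank K (evalSpace S x))
    (hc : codimOp (vanishingAt S x) + e ≤ Module.finrank K V) {d : V} (hd : d ≠ 0)
    (hS : ∀ F : vanishingAt S x →+ V,
      QuasiRangeCompatibleWrt (Submodule.span K {d}) F → IsLocalMap F)
    {F : S →+ V} (hF : QuasiRangeCompatibleWrt (Submodule.span K {d}) F) : IsLocalMap F := by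
  let F' : vanishingAt S x →+ V :=
    { toFun := fun s => F ⟨s.1 ∘ₗ (Submodule.span K {x}).mkQ, s.2⟩
      map_zero' := map_zero F
      map_add' := fun s t => map_add F ⟨s.1 ∘ₗ (Submodule.span K {x}).mkQ, s.2⟩
        ⟨t.1 ∘ₗ (Submodule.span K {x}).mkQ, t.2⟩ }
  obtain ⟨z, hz⟩ := hS F' (fun s hs => by
    have hr : LinearMap.range (s.1 ∘ₗ (Submodule.span K {x}).mkQ) = LinearMap.range s.1 :=
      LinearMap.range_comp_of_range_eq_top _ (Submodule.range_mkQ _)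
    have := hF ⟨s.1 ∘ₗ (Submodule.span K {x}).mkQ, s.2⟩
    rw [hr] at this
    exact this hs)
  obtain ⟨z, rfl⟩ := Submodule.mkQ_surjective _ z
  have h0 : ∀ s : S, s.1 x = 0 → subEval F z s = 0 := by
    intro s hs
    obtain ⟨s', hs', h⟩ := exists_vanishingAt s.2 hs
    have h1 : F ⟨s' ∘ₗ (Submodule.span K {x}).mkQ, hs'⟩ = s' ((Submodule.span K {x}).mkQ z) :=
      hz ⟨s', hs'⟩
    have h2 : (⟨s' ∘ₗ (Submodule.span K {x}).mkQ, hs'⟩ : S) = s := Subtype.ext h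
    rw [h2] at h1
    change F s - s.1 z = 0
    rw [h1, ← h]; simp
  rcases hx with hx | hx
  · refine IsLocalMap.of_subEval (x := z) ⟨0, fun s => ?_⟩
    rw [map_zero]
    refine h0 s ?_
    have : s.1 x ∈ evalSpace S x := mem_evalSpace.2 ⟨s.1, s.2, rfl⟩
    rwa [Submodule.finrank_eq_zero.1 hx] at this
  · exact .of_subEval (isLocalMap_of_eq_zero_of_apply_eq_zero he hK hx hc hd (hF.subEval z) h0)

end

theorem isLocalMap_of_codimOp_add_le {K : Type*} [Field K] {e : ℕ} (he : 2 ≤ e)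
    (hK : 3 ≤ e ∨ ∃ α : K, α ≠ 0 ∧ α ≠ 1) {V : Type*} [AddCommGroup V] [Module K V]
    [FiniteDimensional K V] {d : V} (hd : d ≠ 0) (m : ℕ) {U : Type*} [AddCommGroup U] [Module K U]
    [FiniteDimensional K U] (hm : Module.finrank K U = m) (S : Submodule K (U →ₗ[K] V))
    (hc : codimOp S + e ≤ Module.finrank K V) (F : S →+ V)
    (hF : QuasiRangeCompatibleWrt (Submodule.span K {d}) F) : IsLocalMap F := by
  induction m generalizing U with
  | zero =>
    have : Subsingleton U := Module.finrank_zero_iff.1 hm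
    refine ⟨0, fun s => ?_⟩
    have : s = 0 := Subtype.ext (Subsingleton.elim _ _)
    simp [this]
  | succ m ih =>
    have : Nontrivial U := Module.nontrivial_of_finrank_pos (R := K) (by omega)
    obtain ⟨x, hx⟩ := exists_ne (0 : U)
    have h1 := codimOp_vanishingAt_add S hx
    have h2 := finrank_quotient_span_singleton_add_one (K := K) hx
    have h3 := Submodule.finrank_le (evalSpace S x)
    -- The codimension identity gives both dim S x ≥ dim V - codim S ≥ e and a codimension no larger
    -- for the operators vanishing at `x`.
    exact isLocalMap_of_vanishingAt he hK (.inr (by omega)) (by omega) hd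
      (fun F' hF' => ih (by omega) (vanishingAt S x) (by omega) F' hF') hF

/-! ### Quotients of the target and quadratic minors. -/

section
variable {K U V : Type*} [Field K] [AddCommGroup U] [Module K U] [AddCommGroup V] [Module K V]

/-- The `2 × 2` minors of the values at `y` of the operators dual to `τ₁` and `τ₂`. -/
def minorAt (τ₁ τ₂ : Module.Dual K (U →ₗ[K] V)) (f g : Module.Dual K U) (y : V) : K :=
  τ₁ (f.smulRight y) * τ₂ (g.smulRight y) - τ₁ (g.smulRight y) * τ₂ (f.smulRight y)

theorem LinearMap.smulRight_add_right (f : Module.Dual K U) (y z : V) :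
    f.smulRight (y + z) = f.smulRight y + f.smulRight z := by
  ext; simp

/-- The operators of `S` modulo `y`. -/
def modRange (S : Submodule K (U →ₗ[K] V)) (y : V) :
    Submodule K (U →ₗ[K] (V ⧸ Submodule.span K {y})) :=
  S.map (LinearMap.compRight K (Submodule.span K {y}).mkQ)

theorem mem_modRange {S : Submodule K (U →ₗ[K] V)} {y : V}
    {s : U →ₗ[K] (V ⧸ Submodule.span K {y})} :
    s ∈ modRange S y ↔ ∃ t ∈ S, (Submodule.span K {y}).mkQ ∘ₗ t = s := Iff.rfl

/-- The nonzero minor makes `f ⊗ y` and `g ⊗ y` independent modulo S, while both vanish modulo `y`.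
-/
theorem codimOp_modRange_add_two_le [FiniteDimensional K U] [FiniteDimensional K V]
    (S : Submodule K (U →ₗ[K] V)) {y : V} {τ₁ τ₂ : Module.Dual K (U →ₗ[K] V)}
    (h₁ : τ₁ ∈ S.dualAnnihilator) (h₂ : τ₂ ∈ S.dualAnnihilator) {f g : Module.Dual K U}
    (hq : minorAt τ₁ τ₂ f g y ≠ 0) : codimOp (modRange S y) + 2 ≤ codimOp S := by
  rw [Submodule.mem_dualAnnihilator] at h₁ h₂
  let π : (U →ₗ[K] V) →ₗ[K] (U →ₗ[K] (V ⧸ Submodule.span K {y})) :=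
    LinearMap.compRight K (Submodule.span K {y}).mkQ
  have hπ : Function.Surjective π := fun s => by
    obtain ⟨r, hr⟩ := (Submodule.span K {y}).mkQ.exists_rightInverse_of_surjective
      (Submodule.range_mkQ _)
    refine ⟨r ∘ₗ s, ?_⟩
    change (Submodule.span K {y}).mkQ ∘ₗ r ∘ₗ s = s
    rw [← LinearMap.comp_assoc, hr, LinearMap.id_comp]
  let ρ : ((U →ₗ[K] V) ⧸ S) →ₗ[K] ((U →ₗ[K] (V ⧸ Submodule.span K {y})) ⧸ modRange S y) :=
    Submodule.mapQ S (modRange S y) π (Submodule.le_comap_map _ _)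
  have hρ : LinearMap.range ρ = ⊤ := by
    rw [LinearMap.range_eq_top]
    intro s
    obtain ⟨s, rfl⟩ := Submodule.mkQ_surjective _ s
    obtain ⟨t, rfl⟩ := hπ s
    exact ⟨S.mkQ t, rfl⟩
  have hπ0 : ∀ φ : Module.Dual K U, π (φ.smulRight y) = 0 := fun φ => by
    ext u
    change (Submodule.span K {y}).mkQ (φ u • y) = 0
    exact (Submodule.Quotient.mk_eq_zero _).2
      (Submodule.smul_mem _ _ (Submodule.mem_span_singleton_self y))
  have hker : ∀ φ : Module.Dual K U, S.mkQ (φ.smulRight y) ∈ LinearMap.ker ρ := fun φ => by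
    change (modRange S y).mkQ (π (φ.smulRight y)) = 0
    rw [hπ0, map_zero]
  have hli : LinearIndependent K ![S.mkQ (f.smulRight y), S.mkQ (g.smulRight y)] := by
    rw [LinearIndependent.pair_iff]
    intro a b hab
    rw [← map_smul, ← map_smul, ← map_add, Submodule.mkQ_apply,
      Submodule.Quotient.mk_eq_zero] at hab
    have e1 := h₁ _ hab
    have e2 := h₂ _ hab
    simp only [map_add, map_smul, smul_eq_mul] at e1 e2
    unfold minorAt at hq
    constructor
    · refine (mul_eq_zero.1 (?_ : a * _ = 0)).resolve_right hq
      linear_combination τ₂ (g.smulRight y) * e1 - τ₁ (g.smulRight y) * e2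
    · refine (mul_eq_zero.1 (?_ : b * _ = 0)).resolve_right hq
      linear_combination τ₁ (f.smulRight y) * e2 - τ₂ (f.smulRight y) * e1
  have h2 : 2 ≤ Module.finrank K (LinearMap.ker ρ) := by
    have h := finrank_span_eq_card hli
    refine (h.trans (Fintype.card_fin 2)).ge.trans (?_ : _ ≤ _)
    refine Submodule.finrank_mono (Submodule.span_le.2 ?_)
    rintro _ ⟨i, rfl⟩
    fin_cases i
    · exact hker f
    · exact hker g
  have h3 := LinearMap.finrank_range_add_finrank_ker ρ
  rw [hρ, finrank_top] at h3
  unfold codimOp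
  omega

/-- A minor is a quadratic form in `y`, so its third differences vanish: its value at `a` is a
signed sum of its values at the other six points. This moves a nonzero off prescribed lines. -/
theorem exists_minorAt_ne_zero {τ₁ τ₂ : Module.Dual K (U →ₗ[K] V)} {f g : Module.Dual K U}
    {a : V} (ha : minorAt τ₁ τ₂ f g a ≠ 0) (b c : V) (X : Set V) (hb : b ∈ X) (hc : c ∈ X)
    (hab : a + b ∈ X) (hac : a + c ∈ X) (hbc : b + c ∈ X) (habc : a + b + c ∈ X) :
    ∃ y ∈ X, minorAt τ₁ τ₂ f g y ≠ 0 := by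
  by_contra! h
  refine ha ?_
  have h1 := h _ hb
  have h2 := h _ hc
  have h3 := h _ hab
  have h4 := h _ hac
  have h5 := h _ hbc
  have h6 := h _ habc
  simp only [minorAt, LinearMap.smulRight_add_right, map_add] at *
  linear_combination h3 + h4 + h5 - h1 - h2 - h6

theorem notMem_span_singleton_symm {a d : V} (hd : d ≠ 0) (h : a ∉ Submodule.span K {d}) :
    d ∉ Submodule.span K {a} := by
  intro h'
  obtain ⟨k, hk⟩ := Submodule.mem_span_singleton.1 h'
  have hk0 : k ≠ 0 := by rintro rfl; exact hd (by rw [← hk, zero_smul])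
  exact h (Submodule.mem_span_singleton.2
    ⟨k⁻¹, by rw [← hk, smul_smul, inv_mul_cancel₀ hk0, one_smul]⟩)

theorem smul_add_smul_notMem {a d : V} (hd : d ≠ 0) (h : a ∉ Submodule.span K {d}) {s t : K}
    (hs : s ≠ 0) (ht : t ≠ 0) :
    s • a + t • d ∉ Submodule.span K {a} ∧ s • a + t • d ∉ Submodule.span K {d} := by
  constructor
  · intro h'
    have h1 := sub_mem h' (Submodule.smul_mem _ s (Submodule.mem_span_singleton_self a))
    rw [add_sub_cancel_left] at h1
    exact notMem_span_singleton_symm hd h ((Submodule.smul_mem_iff _ ht).1 h1)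
  · intro h'
    have h1 := sub_mem h' (Submodule.smul_mem _ t (Submodule.mem_span_singleton_self d))
    rw [add_sub_cancel_right] at h1
    exact h ((Submodule.smul_mem_iff _ hs).1 h1)

theorem exists_two_minorAt_ne_zero [FiniteDimensional K V] {e : ℕ} (he : 2 ≤ e)
    (hK : 3 ≤ e ∨ ∃ α : K, α ≠ 0 ∧ α ≠ 1) (hn : e + 1 ≤ Module.finrank K V)
    {τ₁ τ₂ : Module.Dual K (U →ₗ[K] V)} {f g : Module.Dual K U} {a d : V} (hd : d ≠ 0)
    (ha : minorAt τ₁ τ₂ f g a ≠ 0) :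
    ∃ y z, minorAt τ₁ τ₂ f g y ≠ 0 ∧ minorAt τ₁ τ₂ f g z ≠ 0 ∧ y ∉ Submodule.span K {d} ∧
      z ∉ Submodule.span K {d} ∧ z ∉ Submodule.span K {y} := by
  have hex : ∀ Q : Submodule K V, Module.finrank K Q < Module.finrank K V → ∃ r, r ∉ Q := by
    intro Q hQ
    obtain ⟨r, -, hr⟩ := Submodule.exists_notMem_of_finrank_lt ⊤ Q (by rwa [finrank_top])
    exact ⟨r, hr⟩
  obtain ⟨y, hyd, hy⟩ : ∃ y, y ∉ Submodule.span K {d} ∧ minorAt τ₁ τ₂ f g y ≠ 0 := by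
    by_cases had : a ∈ Submodule.span K {d}
    swap
    · exact ⟨a, had, ha⟩
    obtain ⟨b, hb⟩ := hex (Submodule.span K {d}) (by
      have := finrank_span_singleton_le (K := K) d; omega)
    obtain ⟨c, hc⟩ := hex (Submodule.span K {d, b}) (by
      have := finrank_span_pair_le (K := K) d b; omega)
    have hle : Submodule.span K {d} ≤ Submodule.span K {d, b} := Submodule.span_mono (by simp)
    have hbm : b ∈ Submodule.span K {d, b} := Submodule.subset_span (by simp)
    refine exists_minorAt_ne_zero ha b c {y | y ∉ Submodule.span K {d}} hb ?_ ?_ ?_ ?_ ?_ <;>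
      intro h
    · exact hc (hle h)
    · exact hb ((Submodule.add_mem_iff_right _ had).1 h)
    · exact hc (hle ((Submodule.add_mem_iff_right _ had).1 h))
    · exact hc ((Submodule.add_mem_iff_right _ hbm).1 (hle h))
    · exact hc ((Submodule.add_mem_iff_right _ (add_mem (hle had) hbm)).1 (hle h))
  have hy0 : y ≠ 0 := fun h => hyd (h ▸ zero_mem _)
  obtain ⟨b, hby, hbd, hyby, hybd, hbn⟩ : ∃ b, b ∉ Submodule.span K {y} ∧
      b ∉ Submodule.span K {d} ∧ y + b ∉ Submodule.span K {y} ∧ y + b ∉ Submodule.span K {d} ∧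
      Module.finrank K (Submodule.span K {y, d, b}) < Module.finrank K V := by
    rcases hK with hK | ⟨α, hα0, hα1⟩
    · obtain ⟨b, hb⟩ := hex (Submodule.span K {y, d}) (by
        have := finrank_span_pair_le (K := K) y d; omega)
      have hy1 : Submodule.span K {y} ≤ Submodule.span K {y, d} := Submodule.span_mono (by simp)
      have hd1 : Submodule.span K {d} ≤ Submodule.span K {y, d} := Submodule.span_mono (by simp)
      have hym : y ∈ Submodule.span K {y, d} := Submodule.subset_span (by simp)
      refine ⟨b, fun h => hb (hy1 h), fun h => hb (hd1 h),
        fun h => hb ((Submodule.add_mem_iff_right _ hym).1 (hy1 h)),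
        fun h => hb ((Submodule.add_mem_iff_right _ hym).1 (hd1 h)), ?_⟩
      have := finrank_span_triple_le (K := K) y d b
      omega
    -- Taking `b` in the plane of `y` and `d` leaves room for `c` even when dim V = 3; both
    -- coordinates of `b` and of `y + b` are nonzero because `α` is neither 0 nor 1.
    · have h1 := smul_add_smul_notMem hd hyd (neg_ne_zero.2 hα0) hα0
      have h2 := smul_add_smul_notMem hd hyd (sub_ne_zero.2 hα1.symm) hα0
      have h3 : y + (-α • y + α • d) = (1 - α) • y + α • d := by module
      refine ⟨-α • y + α • d, h1.1, h1.2, h3 ▸ h2.1, h3 ▸ h2.2, ?_⟩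
      have h4 : Submodule.span K {y, d, -α • y + α • d} ≤ Submodule.span K {y, d} := by
        have hym : y ∈ Submodule.span K {y, d} := Submodule.subset_span (by simp)
        have hdm : d ∈ Submodule.span K {y, d} := Submodule.subset_span (by simp)
        rw [Submodule.span_le]
        rintro v (rfl | rfl | rfl)
        · exact hym
        · exact hdm
        · exact add_mem (Submodule.smul_mem _ _ hym) (Submodule.smul_mem _ _ hdm)
      have := Submodule.finrank_mono h4
      have := finrank_span_pair_le (K := K) y d
      omega
  obtain ⟨c, hc⟩ := hex _ hbn
  have hyle : Submodule.span K {y} ≤ Submodule.span K {y, d, b} := Submodule.span_mono (by simp)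
  have hdle : Submodule.span K {d} ≤ Submodule.span K {y, d, b} := Submodule.span_mono (by simp)
  have hym : y ∈ Submodule.span K {y, d, b} := Submodule.subset_span (by simp)
  have hbm : b ∈ Submodule.span K {y, d, b} := Submodule.subset_span (by simp)
  have hX : ∀ z, z ∉ Submodule.span K {y, d, b} →
      z ∈ {z | z ∉ Submodule.span K {y} ∧ z ∉ Submodule.span K {d}} :=
    fun z hz => ⟨fun h => hz (hyle h), fun h => hz (hdle h)⟩
  obtain ⟨z, ⟨hzy, hzd⟩, hz⟩ := exists_minorAt_ne_zero hy b c
    {z | z ∉ Submodule.span K {y} ∧ z ∉ Submodule.span K {d}} ⟨hby, hbd⟩ (hX _ hc) ⟨hyby, hybd⟩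
    (hX _ fun h => hc ((Submodule.add_mem_iff_right _ hym).1 h))
    (hX _ fun h => hc ((Submodule.add_mem_iff_right _ hbm).1 h))
    (hX _ fun h => hc ((Submodule.add_mem_iff_right _ (add_mem hym hbm)).1 h))
  exact ⟨y, z, hy, hz, hyd, hzd, hzy⟩

/-- A space of operators whose values at each vector lie on a line has dimension at most `1` or
has all its ranges in a common line. -/
theorem Submodule.finrank_le_one_or_exists_range_le_span {E : Type*} [AddCommGroup E] [Module K E]
    (T : Submodule K (V →ₗ[K] E)) (hT : ∀ y, ∃ u : E, ∀ t ∈ T, t y ∈ Submodule.span K {u}) :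
    Module.finrank K T ≤ 1 ∨ ∃ u : E, ∀ t ∈ T, ∀ y, t y ∈ Submodule.span K {u} := by
  have hT' : ∀ y, ∀ t ∈ T, t y ≠ 0 → ∀ t' ∈ T, t' y ∈ Submodule.span K {t y} := by
    intro y t ht h0 t' ht'
    obtain ⟨u, hu⟩ := hT y
    obtain ⟨a, ha⟩ := Submodule.mem_span_singleton.1 (hu t ht)
    obtain ⟨b, hb⟩ := Submodule.mem_span_singleton.1 (hu t' ht')
    have ha0 : a ≠ 0 := by rintro rfl; exact h0 (by rw [← ha, zero_smul])
    exact Submodule.mem_span_singleton.2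
      ⟨b * a⁻¹, by rw [← ha, ← hb, smul_smul, mul_assoc, inv_mul_cancel₀ ha0, mul_one]⟩
  -- If two operators have crossed kernels, evaluating at `y + z` identifies their lines, and
  -- further sums place all values on that line. Otherwise, subtracting multiples shows that T is
  -- spanned by one operator.
  by_cases hA : ∃ y z, ∃ t ∈ T, ∃ t' ∈ T, t y = 0 ∧ t z ≠ 0 ∧ t' z = 0 ∧ t' y ≠ 0
  · right
    obtain ⟨y, z, t, ht, t', ht', hty, htz, htz', hty'⟩ := hA
    have hle : ∀ {v w : E}, v ∈ Submodule.span K {w} →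
        Submodule.span K {v} ≤ Submodule.span K {w} := fun h => by
      rwa [Submodule.span_singleton_le_iff_mem]
    -- the two lines agree
    have h1 : t' y ∈ Submodule.span K {t z} := by
      have := hT' (y + z) t ht (by rwa [map_add, hty, zero_add]) t' ht'
      rwa [map_add, map_add, hty, htz', zero_add, add_zero] at this
    have h2 : t z ∈ Submodule.span K {t' y} := by
      by_contra h
      exact notMem_span_singleton_symm hty' h h1
    refine ⟨t z, fun t₀ ht₀ w => ?_⟩
    by_cases hw' : t' w = 0
    · have h3 := hT' (y + w) t' ht' (by rwa [map_add, hw', add_zero]) t₀ ht₀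
      rw [map_add, map_add, hw', add_zero] at h3
      exact hle h1 ((Submodule.add_mem_iff_right _ (hT' y t' ht' hty' t₀ ht₀)).1 h3)
    by_cases hw : t w = 0
    · have h3 := hT' (z + w) t ht (by rwa [map_add, hw, add_zero]) t₀ ht₀
      rw [map_add, map_add, hw, add_zero] at h3
      exact (Submodule.add_mem_iff_right _ (hT' z t ht htz t₀ ht₀)).1 h3
    have h3 := hT' (y + w) t ht (by rwa [map_add, hty, zero_add]) t' ht'
    rw [map_add, map_add, hty, zero_add] at h3
    have h4 : t' y ∈ Submodule.span K {t w} :=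
      (Submodule.add_mem_iff_left _ (hT' w t ht hw t' ht')).1 h3
    have h5 : t w ∈ Submodule.span K {t' y} := by
      by_contra h
      exact notMem_span_singleton_symm hty' h h4
    exact hle h1 (hle h5 (hT' w t ht hw t₀ ht₀))
  · left
    by_cases h0 : ∀ t ∈ T, t = 0
    · rw [(Submodule.eq_bot_iff T).2 h0, finrank_bot]; exact zero_le_one
    push Not at h0
    obtain ⟨t₁, ht₁, h0⟩ := h0
    obtain ⟨y, hy⟩ : ∃ y, t₁ y ≠ 0 := by
      by_contra! h
      exact h0 (LinearMap.ext h)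
    refine finrank_le_one ⟨t₁, ht₁⟩ fun t => ?_
    obtain ⟨a, ha⟩ := Submodule.mem_span_singleton.1 (hT' y t₁ ht₁ hy t.1 t.2)
    refine ⟨a, Subtype.ext ?_⟩
    by_contra hne
    have hne' : ∃ z, (t.1 - a • t₁) z ≠ 0 := by
      by_contra! h
      exact hne (sub_eq_zero.1 (LinearMap.ext h : t.1 - a • t₁ = 0)).symm
    obtain ⟨z, hz⟩ := hne'
    have h2T : t.1 - a • t₁ ∈ T := sub_mem t.2 (T.smul_mem _ ht₁)
    obtain ⟨b, hb⟩ := Submodule.mem_span_singleton.1 (hT' z _ h2T hz t₁ ht₁)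
    have h2y : (t.1 - a • t₁) y = 0 := by
      rw [LinearMap.sub_apply, LinearMap.smul_apply, ha, sub_self]
    refine hA ⟨y, z, t.1 - a • t₁, h2T, t₁ - b • (t.1 - a • t₁),
      sub_mem ht₁ (T.smul_mem _ h2T), h2y, hz, ?_, ?_⟩
    · rw [LinearMap.sub_apply, LinearMap.smul_apply, hb, sub_self]
    · rw [LinearMap.sub_apply, LinearMap.smul_apply, h2y, smul_zero, sub_zero]
      exact hy

end

section
variable {K U V : Type*} [Field K] [AddCommGroup U] [Module K U] [AddCommGroup V] [Module K V]

theorem LinearMap.eq_sum_smulRight {ι : Type*} [Fintype ι] (b : Module.Basis ι K V)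
    (s : U →ₗ[K] V) : s = ∑ i, (b.coord i ∘ₗ s).smulRight (b i) := by
  ext u
  simp

/-- The operator from `V` to the bidual of `U` associated with a linear form on operators. -/
def dualOperator : Module.Dual K (U →ₗ[K] V) →ₗ[K]
    (V →ₗ[K] Module.Dual K (Module.Dual K U)) where
  toFun τ := LinearMap.mk₂ K (fun y f => τ (f.smulRight y))
    (fun y z f => by rw [LinearMap.smulRight_add_right, map_add])
    (fun c y f => by rw [← map_smul]; congr 1; ext u; simp [smul_smul, mul_comm])
    (fun y f g => by rw [← map_add]; congr 1; ext u; simp [add_smul])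
    (fun c y f => by rw [← map_smul]; congr 1; ext u; simp [smul_smul])
  map_add' _ _ := rfl
  map_smul' _ _ := rfl

theorem dualOperator_apply (τ : Module.Dual K (U →ₗ[K] V)) (y : V) (f : Module.Dual K U) :
    dualOperator τ y f = τ (f.smulRight y) := rfl


/-- `F` descends modulo `y`: an operator with range in `span {y}` misses `d`, so its image under `F`
lies in `span {y}` too. -/
theorem exists_sub_mem_span_of_modRange {S : Submodule K (U →ₗ[K] V)} {d y : V}
    (hyd : y ∉ Submodule.span K {d}) (hd : d ≠ 0) {F : S →+ V}
    (hF : QuasiRangeCompatibleWrt (Submodule.span K {d}) F)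
    (h : ∀ F' : modRange S y →+ (V ⧸ Submodule.span K {y}), QuasiRangeCompatibleWrt
      (Submodule.span K {(Submodule.span K {y}).mkQ d}) F' → IsLocalMap F') :
    ∃ x : U, ∀ s : S, F s - s.1 x ∈ Submodule.span K {y} := by
  rw [quasiRangeCompatibleWrt_span_singleton_iff] at hF
  have hdy := notMem_span_singleton_symm hd hyd
  let π := (Submodule.span K {y}).mkQ
  let p : S →+ modRange S y :=
    { toFun := fun s => ⟨π ∘ₗ s.1, mem_modRange.2 ⟨s.1, s.2, rfl⟩⟩
      map_zero' := by ext1; simp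
      map_add' := fun s t => by ext1; simp [LinearMap.comp_add] }
  have hπ : ∀ v, π v = 0 ↔ v ∈ Submodule.span K {y} := fun v =>
    Submodule.Quotient.mk_eq_zero _
  obtain ⟨F', hF'⟩ := AddMonoidHom.exists_factor p
    (fun s => by
      obtain ⟨t, ht, h⟩ := mem_modRange.1 s.2
      exact ⟨⟨t, ht⟩, Subtype.ext h⟩) (π.toAddMonoidHom.comp F) (by
    intro s hs
    have hr : LinearMap.range s.1 ≤ Submodule.span K {y} := by
      rintro _ ⟨u, rfl⟩
      exact (hπ _).1 (LinearMap.congr_fun (congrArg Subtype.val hs) u)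
    exact (hπ _).2 (hr (hF s fun h => hdy (hr h))))
  obtain ⟨x, hx⟩ := h F' (by
    rw [quasiRangeCompatibleWrt_span_singleton_iff]
    intro s hs
    obtain ⟨t, ht, hts⟩ := mem_modRange.1 s.2
    obtain rfl : p ⟨t, ht⟩ = s := Subtype.ext hts
    rw [hF']
    have hdt : d ∉ LinearMap.range t := by
      rintro ⟨u, hu⟩
      exact hs ⟨u, by rw [← hu]; rfl⟩
    obtain ⟨u, hu⟩ := hF ⟨t, ht⟩ hdt
    exact ⟨u, congrArg π hu⟩)
  refine ⟨x, fun s => ?_⟩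
  have h1 : π (F s) = π (s.1 x) := by
    have h2 := hx (p s)
    rw [hF'] at h2
    exact h2
  rw [← hπ, map_sub, h1, sub_self]

variable [FiniteDimensional K V]

theorem dualOperator_injective : Function.Injective (dualOperator (K := K) (U := U) (V := V)) := by
  refine (injective_iff_map_eq_zero _).2 fun τ hτ => ?_
  ext s
  rw [LinearMap.eq_sum_smulRight (Module.finBasis K V) s, map_sum]
  refine Finset.sum_eq_zero fun i _ => ?_
  rw [← dualOperator_apply, hτ]; rfl

variable [FiniteDimensional K U]

/-- Vanishing minors mean that the operators dual to the annihilator of S take values on a line at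
each vector. If they share a single line, generated by the image of `u`, the annihilator kills every
operator vanishing at `u`. -/
theorem codimOp_le_one_or_of_minorAt_eq_zero (S : Submodule K (U →ₗ[K] V))
    (h : ∀ τ₁ ∈ S.dualAnnihilator, ∀ τ₂ ∈ S.dualAnnihilator, ∀ (f g : Module.Dual K U) (y : V),
      minorAt τ₁ τ₂ f g y = 0) :
    codimOp S ≤ 1 ∨
      ∃ u : U, u ≠ 0 ∧ codimOp S + Module.finrank K (evalSpace S u) = Module.finrank K V := by
  set T := S.dualAnnihilator.map dualOperator with hT
  have hTc : Module.finrank K T = codimOp S := by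
    rw [← finrank_dualAnnihilator_eq_codimOp]
    exact (Submodule.equivMapOfInjective _ dualOperator_injective _).finrank_eq.symm
  have h1 : ∀ y, ∃ u, ∀ t ∈ T, t y ∈ Submodule.span K {u} := by
    intro y
    by_cases h0 : ∀ t ∈ T, t y = 0
    · exact ⟨0, fun t ht => by rw [h0 t ht]; exact zero_mem _⟩
    push Not at h0
    obtain ⟨_, ⟨τ, hτ, rfl⟩, h0⟩ := h0
    obtain ⟨g, hg⟩ : ∃ g, dualOperator τ y g ≠ 0 := by
      by_contra! h'
      exact h0 (LinearMap.ext h')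
    refine ⟨dualOperator τ y, ?_⟩
    rintro _ ⟨τ', hτ', rfl⟩
    refine Submodule.mem_span_singleton.2 ⟨dualOperator τ' y g / dualOperator τ y g, ?_⟩
    ext f
    have h2 := h τ hτ τ' hτ' f g y
    simp only [minorAt, ← dualOperator_apply] at h2
    rw [LinearMap.smul_apply, smul_eq_mul, div_mul_eq_mul_div, div_eq_iff hg]
    linear_combination h2
  rcases Submodule.finrank_le_one_or_exists_range_le_span T h1 with h2 | ⟨ξ, hξ⟩
  · exact .inl (hTc ▸ h2)
  obtain ⟨u, rfl⟩ := (Module.evalEquiv K U).surjective ξ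
  by_cases hu : u = 0
  · left
    have : T = ⊥ := by
      rw [Submodule.eq_bot_iff]
      intro t ht
      ext1 y
      have := hξ t ht y
      rw [hu, map_zero, Submodule.span_zero_singleton, Submodule.mem_bot] at this
      rw [this]; rfl
    rw [← hTc, this, finrank_bot]
    exact zero_le_one
  refine .inr ⟨u, hu, ?_⟩
  have htop : vanishingAt S u = ⊤ := by
    rw [eq_top_iff]
    intro s _
    rw [mem_vanishingAt, ← Subspace.forall_mem_dualAnnihilator_apply_eq_zero_iff]
    intro τ hτ
    rw [LinearMap.eq_sum_smulRight (Module.finBasis K V) (s ∘ₗ _), map_sum]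
    refine Finset.sum_eq_zero fun i _ => ?_
    obtain ⟨k, hk⟩ := Submodule.mem_span_singleton.1
      (hξ _ (Submodule.mem_map_of_mem hτ) (Module.finBasis K V i))
    rw [← dualOperator_apply, ← hk, LinearMap.smul_apply, Module.evalEquiv_apply,
      Module.Dual.eval_apply]
    have hx : (Submodule.span K {u}).mkQ u = 0 :=
      (Submodule.Quotient.mk_eq_zero _).2 (Submodule.mem_span_singleton_self u)
    rw [LinearMap.comp_apply, LinearMap.comp_apply, hx, map_zero, map_zero, smul_zero]
  have h2 := codimOp_vanishingAt_add S hu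
  have h3 := codimOp_add_finrank (vanishingAt S u)
  rw [htop, finrank_top, Module.finrank_linearMap] at h3
  rw [htop] at h2
  omega


end

/-! ### The induction on the dimension of the target. -/

theorem isLocalMap_of_finrank_evalSpace {K : Type*} [Field K] {e : ℕ} (he : 2 ≤ e)
    (hK : 3 ≤ e ∨ ∃ α : K, α ≠ 0 ∧ α ≠ 1) {U : Type*} [AddCommGroup U] [Module K U]
    [FiniteDimensional K U] (n : ℕ) {V : Type*} [AddCommGroup V] [Module K V]
    [FiniteDimensional K V] (hn : Module.finrank K V = n) {d : V} (hd : d ≠ 0)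
    (S : Submodule K (U →ₗ[K] V))
    (hS : ∀ x, Module.finrank K (evalSpace S x) = 0 ∨ e ≤ Module.finrank K (evalSpace S x))
    (hc : codimOp S + 2 * e ≤ 2 * n) (F : S →+ V)
    (hF : QuasiRangeCompatibleWrt (Submodule.span K {d}) F) : IsLocalMap F := by
  induction n generalizing V with
  | zero => omega
  | succ n ih =>
  by_cases hA : ∃ x : U, x ≠ 0 ∧ Module.finrank K (evalSpace S x) ≤ e
  · obtain ⟨x, hx, hxe⟩ := hA
    have h1 := codimOp_vanishingAt_add S hx
    exact isLocalMap_of_vanishingAt he hK (hS x) (by omega) hd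
      (fun F' hF' => isLocalMap_of_codimOp_add_le he hK hd _ rfl _ (by omega) F' hF') hF
  -- From here dim S x ≥ e + 1 for all nonzero `x`, so the bound `e` survives a quotient of V by a
  -- line.
  push Not at hA
  by_cases hc' : codimOp S + e ≤ n + 1
  · exact isLocalMap_of_codimOp_add_le he hK hd _ rfl S (by omega) F hF
  obtain ⟨x₀, hx₀⟩ : ∃ x : U, x ≠ 0 := by
    by_contra! h
    have : Subsingleton U := ⟨fun a b => by rw [h a, h b]⟩
    have h1 := codimOp_add_finrank S
    rw [Module.finrank_zero_of_subsingleton (R := K) (M := U), zero_mul] at h1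
    omega
  have hn1 : e + 1 ≤ n + 1 := by
    have h1 := Submodule.finrank_le (evalSpace S x₀)
    have h2 := hA x₀ hx₀
    omega
  by_cases hq : ∀ τ₁ ∈ S.dualAnnihilator, ∀ τ₂ ∈ S.dualAnnihilator,
      ∀ (f g : Module.Dual K U) (y : V), minorAt τ₁ τ₂ f g y = 0
  · rcases codimOp_le_one_or_of_minorAt_eq_zero S hq with h | ⟨u, hu, h⟩
    · omega
    · have := hA u hu
      omega
  push Not at hq
  obtain ⟨τ₁, hτ₁, τ₂, hτ₂, f, g, a, ha⟩ := hq
  obtain ⟨y, z, hy, hz, hyd, hzd, hzy⟩ :=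
    exists_two_minorAt_ne_zero he hK (hn ▸ hn1) hd ha
  have hmod : ∀ y, minorAt τ₁ τ₂ f g y ≠ 0 → y ∉ Submodule.span K {d} →
      ∃ x : U, ∀ s : S, F s - s.1 x ∈ Submodule.span K {y} := by
    intro y hy hyd
    have hy0 : y ≠ 0 := fun h => hyd (h ▸ zero_mem _)
    refine exists_sub_mem_span_of_modRange hyd hd hF fun F' hF' => ?_
    have h1 := codimOp_modRange_add_two_le S hτ₁ hτ₂ hy
    have h2 := finrank_quotient_span_singleton_add_one (K := K) hy0
    refine ih (by omega) (d := (Submodule.span K {y}).mkQ d) (fun h => ?_) (modRange S y)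
      (fun x => ?_) (by omega) F' hF'
    · exact notMem_span_singleton_symm hd hyd ((Submodule.Quotient.mk_eq_zero _).1 h)
    · by_cases hx : x = 0
      · left
        rw [Submodule.finrank_eq_zero, Submodule.eq_bot_iff]
        rintro v hv
        obtain ⟨s, -, rfl⟩ := mem_evalSpace.1 hv
        rw [hx, map_zero]
      · right
        have h3 : evalSpace (modRange S y) x = (evalSpace S x).map (Submodule.span K {y}).mkQ := by
          ext v
          constructor
          · rintro ⟨_, ⟨s, hs, rfl⟩, rfl⟩
            exact ⟨s x, ⟨s, hs, rfl⟩, rfl⟩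
          · rintro ⟨_, ⟨s, hs, rfl⟩, rfl⟩
            exact ⟨_, ⟨s, hs, rfl⟩, rfl⟩
        have h4 := LinearMap.finrank_range_add_finrank_ker
          ((Submodule.span K {y}).mkQ.domRestrict (evalSpace S x))
        rw [LinearMap.range_domRestrict, ← h3] at h4
        have h5 : Module.finrank K (LinearMap.ker
            ((Submodule.span K {y}).mkQ.domRestrict (evalSpace S x))) ≤ 1 := by
          rw [← Submodule.finrank_map_subtype_eq]
          refine (Submodule.finrank_mono ?_).trans (finrank_span_singleton_le (K := K) y)
          rintro _ ⟨v, hv, rfl⟩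
          exact (Submodule.Quotient.mk_eq_zero _).1 hv
        have h6 := hA x hx
        omega
  obtain ⟨x₁, h₁⟩ := hmod y hy hyd
  obtain ⟨x₂, h₂⟩ := hmod z hz hzd
  -- `S (x₁ - x₂)` lies in the plane of `y` and `z`, while nonzero vectors have evaluation spaces of
  -- dimension greater than `e ≥ 2`.
  have hx : x₁ = x₂ := by
    by_contra hne
    have h1 := hA (x₁ - x₂) (sub_ne_zero.2 hne)
    have h2 : evalSpace S (x₁ - x₂) ≤ Submodule.span K {y, z} := by
      intro v hv
      obtain ⟨s, hs, rfl⟩ := mem_evalSpace.1 hv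
      have h3 : s (x₁ - x₂) = (F ⟨s, hs⟩ - s x₂) - (F ⟨s, hs⟩ - s x₁) := by
        rw [map_sub]; abel
      rw [h3]
      exact sub_mem (Submodule.span_mono (by simp) (h₂ ⟨s, hs⟩))
        (Submodule.span_mono (by simp) (h₁ ⟨s, hs⟩))
    have h3 := Submodule.finrank_mono h2
    have h4 := finrank_span_pair_le (K := K) y z
    omega
  subst hx
  refine ⟨x₁, fun s => ?_⟩
  obtain ⟨a, ha⟩ := Submodule.mem_span_singleton.1 (h₁ s)
  obtain ⟨b, hb⟩ := Submodule.mem_span_singleton.1 (h₂ s)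
  have hy0 : y ≠ 0 := fun h => hyd (h ▸ zero_mem _)
  have h3 := eq_zero_of_smul_add_smul_eq_zero hy0 hzy (s := a) (t := -b)
    (by rw [ha, neg_smul, hb, add_neg_cancel])
  rw [h3.1, zero_smul] at ha
  exact sub_eq_zero.1 ha.symm

/-! ### Linear maps with a target plane. -/

theorem Submodule.exists_smul_eq_of_finrank_le_one {K W : Type*} [Field K] [AddCommGroup W]
    [Module K W] [FiniteDimensional K W] (P : Submodule K W) (hP : Module.finrank K P ≤ 1) :
    ∃ v : W, ∀ w ∈ P, ∃ c : K, c • v = w := by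
  obtain ⟨v, hv⟩ := finrank_le_one_iff.1 hP
  refine ⟨v, fun w hw => ?_⟩
  obtain ⟨c, hc⟩ := hv ⟨w, hw⟩
  exact ⟨c, congrArg Subtype.val hc⟩

theorem isLocalMap_of_codimOp_le_one {K U V : Type*} [Field K] [AddCommGroup U] [Module K U]
    [FiniteDimensional K U] [AddCommGroup V] [Module K V] [FiniteDimensional K V]
    (hn : Module.finrank K V = 2) {α β : K} (hα0 : α ≠ 0) (hα1 : α ≠ 1) (hβ0 : β ≠ 0)
    (hβ1 : β ≠ 1) (hαβ : α ≠ β) (S : Submodule K (U →ₗ[K] V)) (hc : codimOp S ≤ 1)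
    (hS : ∀ x, x ≠ 0 → evalSpace S x = ⊤) {d : V} (hd : d ≠ 0) (F : S →ₗ[K] V)
    (hF : QuasiRangeCompatibleWrt (Submodule.span K {d}) F) : IsLocalMap F := by
  rw [quasiRangeCompatibleWrt_span_singleton_iff] at hF
  -- If `φ ∘ s = 0` then `d` is not in the range of `s`, so `φ (F s) = 0`. Thus `φ ∘ F` factors
  -- linearly through `s ↦ φ ∘ s`, and biduality supplies `x`.
  have key : ∀ φ : Module.Dual K V, φ d ≠ 0 → ∃ x : U, ∀ s : S, φ (F s) = φ (s.1 x) := by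
    intro φ hφ
    let T : S →ₗ[K] Module.Dual K U :=
      { toFun := fun s => φ ∘ₗ s.1
        map_add' := fun s t => by ext; simp
        map_smul' := fun c s => by ext; simp }
    have h1 : φ ∘ₗ F ∈ LinearMap.range T.dualMap := by
      rw [LinearMap.range_dualMap_eq_dualAnnihilator_ker, Submodule.mem_dualAnnihilator]
      intro s hs
      have hs' : ∀ u, φ (s.1 u) = 0 := fun u => LinearMap.congr_fun hs u
      obtain ⟨u, hu⟩ := hF s (by rintro ⟨u, hu⟩; exact hφ (hu ▸ hs' u))
      rw [LinearMap.comp_apply, ← hu, hs']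
    obtain ⟨ξ, hξ⟩ := h1
    obtain ⟨x, rfl⟩ := (Module.evalEquiv K U).surjective ξ
    exact ⟨x, fun s => (LinearMap.congr_fun hξ s).symm⟩
  obtain ⟨φ, hφ⟩ : ∃ φ : Module.Dual K V, φ d ≠ 0 := by
    by_contra! h
    exact hd ((Module.forall_dual_apply_eq_zero_iff K _).1 h)
  obtain ⟨w, -, hw⟩ := Submodule.exists_notMem_of_finrank_lt ⊤ (Submodule.span K {d}) (by
    have := finrank_span_singleton_le (K := K) d
    rw [finrank_top]; omega)
  obtain ⟨ψ, hψw, hψ⟩ := Submodule.exists_le_ker_of_notMem hw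
  have hψd : ψ d = 0 := hψ (Submodule.mem_span_singleton_self d)
  have hinj : ∀ v, φ v = 0 → ψ v = 0 → v = 0 := by
    intro v h1 h2
    have htop : Submodule.span K {d, w} = ⊤ := by
      refine Submodule.eq_top_of_finrank_eq (le_antisymm (Submodule.finrank_le _) ?_)
      have hlt : Submodule.span K {d} < Submodule.span K {d, w} := by
        refine lt_of_le_of_ne (Submodule.span_mono (by simp)) fun h => hw ?_
        rw [h]; exact Submodule.subset_span (by simp)
      have h3 := Submodule.finrank_lt_finrank_of_lt hlt
      rw [finrank_span_singleton hd] at h3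
      omega
    obtain ⟨a, b, rfl⟩ := Submodule.mem_span_pair.1 (htop ▸ Submodule.mem_top : v ∈ _)
    simp only [map_add, map_smul, hψd, smul_eq_mul, mul_zero, zero_add, mul_eq_zero, hψw,
      or_false] at h2
    subst h2
    simp only [zero_smul, add_zero, map_smul, smul_eq_mul, mul_eq_zero, hφ, or_false] at h1
    simp [h1]
  obtain ⟨x₀, hx₀⟩ := key φ hφ
  have keyl : ∀ l : K, ∃ x : U, ∀ s : S,
      l * ψ (F s - s.1 x₀) = φ (s.1 x) + l * ψ (s.1 x) := by
    intro l
    obtain ⟨x, hx⟩ := key (φ + l • ψ) (by simpa [hψd] using hφ)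
    refine ⟨x - x₀, fun s => ?_⟩
    have h1 := hx s
    have h2 := hx₀ s
    simp only [LinearMap.add_apply, LinearMap.smul_apply, smul_eq_mul] at h1
    simp only [map_sub]
    linear_combination h1 - h2
  let θ : U → U → Module.Dual K (U →ₗ[K] V) := fun a b =>
    φ ∘ₗ LinearMap.applyₗ a + ψ ∘ₗ LinearMap.applyₗ b
  have hθ : ∀ a b s, θ a b s = φ (s a) + ψ (s b) := fun _ _ _ => rfl
  have hθ0 : ∀ a b, θ a b = 0 → a = 0 ∧ b = 0 := by
    intro a b h
    have ha : a = 0 := by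
      rw [← Module.forall_dual_apply_eq_zero_iff K]
      intro f
      have := LinearMap.congr_fun h (f.smulRight d)
      simpa [hθ, hψd, hφ] using this
    refine ⟨ha, ?_⟩
    rw [← Module.forall_dual_apply_eq_zero_iff K]
    intro f
    have := LinearMap.congr_fun h (f.smulRight w)
    simpa [hθ, hψw, ha] using this
  obtain ⟨x, hx⟩ := keyl 1
  -- Eliminate `ψ (F s - s x₀)` between the relations of `keyl` for `1` and for `l`.
  have hθS : ∀ l : K, ∃ z : U, θ (z + (1 - l) • x) (l • z) ∈ S.dualAnnihilator := by
    intro l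
    obtain ⟨x', hx'⟩ := keyl l
    refine ⟨x' - x, ?_⟩
    rw [Submodule.mem_dualAnnihilator]
    intro s hs
    have h1 := hx ⟨s, hs⟩
    have h2 := hx' ⟨s, hs⟩
    rw [hθ]
    simp only [map_add, map_sub, map_smul, smul_eq_mul] at *
    linear_combination l * h1 - h2
  have hx0 : x = 0 := by
    by_contra hx0
    obtain ⟨z₁, hz₁⟩ := hθS α
    obtain ⟨z₂, hz₂⟩ := hθS β
    have hne : ∀ (l : K) (z : U), l ≠ 0 → l ≠ 1 → θ (z + (1 - l) • x) (l • z) ≠ 0 := by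
      intro l z h0 h1 h
      obtain ⟨ha, hb⟩ := hθ0 _ _ h
      have hz : z = 0 := (smul_eq_zero.1 hb).resolve_left h0
      rw [hz, zero_add] at ha
      exact hx0 ((smul_eq_zero.1 ha).resolve_left (sub_ne_zero.2 h1.symm))
    obtain ⟨v, hv⟩ := Submodule.exists_smul_eq_of_finrank_le_one S.dualAnnihilator
      ((finrank_dualAnnihilator_eq_codimOp S).trans_le hc)
    obtain ⟨c₁, e₁⟩ := hv _ hz₁
    obtain ⟨c₂, e₂⟩ := hv _ hz₂
    have hc₂0 : c₂ ≠ 0 := by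
      rintro rfl
      rw [zero_smul] at e₂
      exact hne β z₂ hβ0 hβ1 e₂.symm
    have h0 := hθ0 (c₂ • (z₁ + (1 - α) • x) - c₁ • (z₂ + (1 - β) • x))
      (c₂ • (α • z₁) - c₁ • (β • z₂)) (by
        have h1 : c₂ • θ (z₁ + (1 - α) • x) (α • z₁) - c₁ • θ (z₂ + (1 - β) • x) (β • z₂) = 0 := by
          rw [← e₁, ← e₂]; module
        rw [← h1]
        ext s
        simp only [hθ, LinearMap.sub_apply, LinearMap.smul_apply, map_add, map_sub, map_smul,
          smul_eq_mul]
        ring)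
    obtain ⟨ha, hb⟩ := h0
    -- Proportionality of the two annihilating forms, after eliminating `z₂`, puts `z₁` on the line
    -- of `x`; a nontrivial linear form would then vanish on `S x = V`.
    have hz : (c₂ * (β - α)) • z₁ = (β * (c₁ * (1 - β) - c₂ * (1 - α))) • x := by
      rw [← sub_eq_zero]
      have : β • (c₂ • (z₁ + (1 - α) • x) - c₁ • (z₂ + (1 - β) • x)) -
        (c₂ • (α • z₁) - c₁ • (β • z₂)) = 0 := by rw [ha, hb]; simp
      rw [← this]; module
    have hk0 : c₂ * (β - α) ≠ 0 := mul_ne_zero hc₂0 (sub_ne_zero.2 hαβ.symm)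
    obtain ⟨k, rfl⟩ : ∃ k : K, z₁ = k • x :=
      ⟨(c₂ * (β - α))⁻¹ * (β * (c₁ * (1 - β) - c₂ * (1 - α))), by
        rw [mul_smul, ← hz, smul_smul, inv_mul_cancel₀ hk0, one_smul]⟩
    rw [Submodule.mem_dualAnnihilator] at hz₁
    have hv : ∀ v : V, (k + (1 - α)) * φ v + α * k * ψ v = 0 := by
      intro v
      obtain ⟨s, hs, rfl⟩ := mem_evalSpace.1 (hS x hx0 ▸ Submodule.mem_top : v ∈ evalSpace S x)
      have := hz₁ s hs
      simp only [hθ, map_add, map_smul, smul_eq_mul] at this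
      linear_combination this
    have h1 := hv d
    have h2 := hv w
    rw [hψd, mul_zero, add_zero] at h1
    have h3 := (mul_eq_zero.1 h1).resolve_right hφ
    rw [h3, zero_mul, zero_add] at h2
    have h4 := (mul_eq_zero.1 ((mul_eq_zero.1 h2).resolve_right hψw)).resolve_left hα0
    rw [h4, zero_add] at h3
    exact hα1 (sub_eq_zero.1 h3).symm
  refine ⟨x₀, fun s => sub_eq_zero.1 (hinj _ ?_ ?_)⟩
  · rw [map_sub, hx₀, sub_self]
  · simpa [hx0] using hx s

/-! ### Assembling the three statements. -/

theorem QuasiRangeCompatible.exists_span_singleton {K U V : Type*} [Field K] [AddCommGroup U]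
    [Module K U] [AddCommGroup V] [Module K V] {S : Submodule K (U →ₗ[K] V)} {F : S → V}
    (hF : QuasiRangeCompatible F) :
    ∃ d : V, d ≠ 0 ∧ QuasiRangeCompatibleWrt (Submodule.span K {d}) F := by
  obtain ⟨D, hD, hF⟩ := hF
  obtain ⟨d, hd, h⟩ := finrank_eq_one_iff'.1 hD
  have hDd : D = Submodule.span K {d.1} := by
    apply le_antisymm
    · intro v hv
      obtain ⟨c, hc⟩ := h ⟨v, hv⟩
      exact Submodule.mem_span_singleton.2 ⟨c, congrArg Subtype.val hc⟩
    · rw [Submodule.span_singleton_le_iff_mem]; exact d.2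
  exact ⟨d, fun h0 => hd (Subtype.ext h0), hDd ▸ hF⟩

theorem Finset.exists_notMem_of_card_lt_card {K : Type*} (s : Finset K) {n : ℕ}
    (hs : s.card ≤ n) (h : n < ENat.card K) : ∃ a, a ∉ s := by
  by_contra! hc
  have h1 : ENat.card K = s.card := by
    rw [← Set.encard_univ, ← Set.encard_coe_eq_coe_finsetCard]
    congr 1
    exact (Set.eq_univ_of_forall fun a => Finset.mem_coe.2 (hc a)).symm
  rw [h1, Nat.cast_lt] at h
  omega

theorem mainTheorem7 {K U V : Type*} [Field K] [AddCommGroup U] [Module K U]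
    [FiniteDimensional K U] [AddCommGroup V] [Module K V] [FiniteDimensional K V]
    (S : Submodule K (U →ₗ[K] V)) :
    (3 < ENat.card K → (codimOp S : ℤ) ≤ 2 * (Module.finrank K V : ℤ) - 3 →
        Module.finrank K V = 2 →
        IsSpecialOfType S 1 ∨ ∀ F : S →ₗ[K] V, QuasiRangeCompatible (⇑F) → IsLocalMap (⇑F)) ∧
    (2 < ENat.card K → (codimOp S : ℤ) ≤ 2 * (Module.finrank K V : ℤ) - 4 →
        IsSpecialOfType S 1 ∨ ∀ F : S →+ V, QuasiRangeCompatible (⇑F) → IsLocalMap (⇑F)) ∧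
    (ENat.card K = 2 → (codimOp S : ℤ) ≤ 2 * (Module.finrank K V : ℤ) - 6 →
        (IsSpecialOfType S 1 ∨ IsSpecialOfType S 2) ∨
          ∀ F : S →+ V, QuasiRangeCompatible (⇑F) → IsLocalMap (⇑F)) := by
  classical
  have h2 : 2 < ENat.card K → ∃ α : K, α ≠ 0 ∧ α ≠ 1 := by
    intro hK
    obtain ⟨α, hα⟩ := Finset.exists_notMem_of_card_lt_card {(0 : K), 1} Finset.card_le_two hK
    exact ⟨α, by simpa using hα⟩
  refine ⟨fun hK hc hn => ?_, fun hK hc => ?_, fun _ hc => ?_⟩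
  · refine or_iff_not_imp_left.2 fun h1 F hF => ?_
    obtain ⟨d, hd, hF⟩ := hF.exists_span_singleton
    obtain ⟨α, hα0, hα1⟩ := h2 (lt_trans (by norm_num) hK)
    obtain ⟨β, hβ⟩ := Finset.exists_notMem_of_card_lt_card {α, 0, 1} Finset.card_le_three hK
    simp only [Finset.mem_insert, Finset.mem_singleton, not_or] at hβ
    refine isLocalMap_of_codimOp_le_one hn hα0 hα1 hβ.2.1 hβ.2.2 (Ne.symm hβ.1) S (by omega)
      (fun x hx => ?_) hd F hF
    -- As codim S < 2 = dim V, this identity excludes `S x = 0`; dimension 1 is excluded by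
    -- hypothesis.
    have e1 := codimOp_vanishingAt_add S hx
    have e2 : Module.finrank K (evalSpace S x) ≠ 1 := fun h => h1 ⟨x, h⟩
    have e3 := Submodule.finrank_le (evalSpace S x)
    exact Submodule.eq_top_of_finrank_eq (by omega)
  · refine or_iff_not_imp_left.2 fun h1 F hF => ?_
    obtain ⟨d, hd, hF⟩ := hF.exists_span_singleton
    refine isLocalMap_of_finrank_evalSpace (e := 2) le_rfl (.inr (h2 hK)) _ rfl hd S
      (fun x => ?_) (by omega) F hF
    have e1 : Module.finrank K (evalSpace S x) ≠ 1 := fun h => h1 ⟨x, h⟩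
    omega
  · refine or_iff_not_imp_left.2 fun h1 F hF => ?_
    obtain ⟨d, hd, hF⟩ := hF.exists_span_singleton
    refine isLocalMap_of_finrank_evalSpace (e := 3) (by norm_num) (.inl le_rfl) _ rfl hd S
      (fun x => ?_) (by omega) F hF
    have e1 : Module.finrank K (evalSpace S x) ≠ 1 := fun h => h1 (.inl ⟨x, h⟩)
    have e2 : Module.finrank K (evalSpace S x) ≠ 2 := fun h => h1 (.inr ⟨x, h⟩)
    omega
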